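/- Let $\mathfrak A$ be a unital C*-algebra with unit $1$, and let $(\mathfrak A,\mathsf L)$ be a Lipschitz pair: $\mathsf L$ is a seminorm defined on a dense real subspace of the self-adjoint part $\mathfrak{sa}(\mathfrak A)$, with $\{a\in\mathfrak{sa}(\mathfrak A):\mathsf L(a)=0\}=\mathbb R1$ (and $\mathsf L(a)=\infty$ outside the domain). **Definitions.** $\mathscr S(\mathfrak A)$ is the state space. For states $\varphi,\psi$ put $\mathsf{mk}_{\mathsf L}(\varphi,\psi)=\sup\{|\varphi(a)-\psi(a)|: a\in\mathfrak{sa}(\mathfrak A),\ \mathsf L(a)\le 1\}\in[0,\infty]$ (the extended Monge–Kantorovich metric), and for a state $\mu$ put $\mathfrak L_1(\mu)=\{a\in\mathfrak{sa}(\mathfrak A):\mathsf L(a)\le1,\ \mu(a)=0\}$. An Abelian C*-subalgebra $\mathfrak M\subseteq\mathfrak A$ is a *topography* of $\mathfrak A$ if it contains an approximate identity of $\mathfrak A$. In that case, let $\sigma(\mathfrak M)$ be its Gelfand spectrum; for a compact $K\subseteq\sigma(\mathfrak M)$ the indicator function $1_K$ is regarded as an element of $\mathfrak M^{**}\subseteq\mathfrak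 A^{**}$, the enveloping von Neumann algebra, to which functionals on $\mathfrak A$ extend canonically. Put $\mathscr S(\mathfrak A|K)=\{\varphi\in\mathscr S(\mathfrak A):\varphi(1_K)=1\}$; a state is *local* if it lies in $\mathscr S(\mathfrak A|K)$ for some compact $K$. A set $\mathscr K$ of states is *tame* if for some local state $\mu$ $$\lim_{K}\ \sup\{|\varphi(a-1_Ka1_K)| : a\in\mathfrak L_1(\mu),\ \varphi\in\mathscr K\}=0,$$ the limit being taken along the compact subsets $K$ of $\sigma(\mathfrak M)$ directed by inclusion. The triple $(\mathfrak A,\mathsf L,\mathfrak M)$ is a *quantum locally compact metric space* if $\mathfrak M$ is a topography of $\mathfrak A$, if $\mathscr S(\mathfrak A|K)$ has finite $\mathsf{mk}_{\mathsf L}$-diameter for every compact $K\subseteq\sigma(\mathfrak M)$, and if on every tame set of states $\mathsf{mk}_{\mathsf L}$ induces the relative weak* topology. It is *separable* if moreover $\mathfrak A$ is separable. The pair $(\mathfrak A,\mathsf L)$ is a *compact quantum metric space* (Rieffel) if $\mathsf L(a)=0$ exactly when $a$ is a real multiple of $1$, $\mathscr S(\mathfrak A)$ has finite $\mathsf{mk}_{\mathsf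 L}$-diameter, and the image of $\{a\in\mathfrak{sa}(\mathfrak A):\mathsf L(a)\le1\}$ in $\mathfrak A/\mathbb C1$ is totally bounded for the quotient norm. An element $h\in\mathfrak A$ is *strictly positive* if $h\ge0$ and $\varphi(h)>0$ for every state $\varphi$; $C^*(h)$ is the C*-subalgebra generated by $h$ (without adjoining a unit). **Theorem.** An Abelian C*-subalgebra $\mathfrak M$ of $\mathfrak A$ is a topography of $\mathfrak A$ if and only if $1\in\mathfrak M$. Moreover, the following are equivalent: 1. $(\mathfrak A,\mathsf L)$ is a compact quantum metric space; 2. $(\mathfrak A,\mathsf L,\mathbb C1)$ is a quantum locally compact metric space; 3. for all Abelian C*-subalgebras $\mathfrak M$ of $\mathfrak A$ with $1\in\mathfrak M$, $(\mathfrak A,\mathsf L,\mathfrak M)$ is a quantum locally compact separable metric space; 4. there is an Abelian C*-subalgebra $\mathfrak M$ of $\mathfrak A$ with $1\in\mathfrak M$ such that $(\mathfrak A,\mathsf L,\mathfrak M)$ is a quantum locally compact metric space; 5. for all strictly positive $h\in\mathfrak A$, $(\mathfrak A,\mathsf L,C^*(h))$ is a quantum locally compact separable metric space; 6. there is a strictly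 positive $h\in\mathfrak A$ such that $(\mathfrak A,\mathsf L,C^*(h))$ is a quantum locally compact metric space. -/

import Mathlib

open Filter Topology Set TopologicalSpace
open scoped ComplexOrder ENNReal

noncomputable section

namespace QuantumMetric

/-! ### Abelian C*-subalgebras and topographies -/

/-- An Abelian C*-subalgebra of `A`: a norm closed, commutative `*`-subalgebra. It need not
contain a unit. -/
structure AbelianCStarSubalgebra (A : Type*) [CStarAlgebra A] where
  toSubalgebra : NonUnitalStarSubalgebra ℂ A
  isClosed : IsClosed (toSubalgebra : Set A)
  mul_comm : ∀ a ∈ toSubalgebra, ∀ b ∈ toSubalgebra, a * b = b * a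

namespace AbelianCStarSubalgebra

variable {A : Type*} [CStarAlgebra A]

/-- `M` is a topography of `A` when `M` contains an approximate identity of `A`. -/
def IsTopography (M : AbelianCStarSubalgebra A) : Prop :=
  ∃ l : Filter A, l.IsApproximateUnit ∧ (M.toSubalgebra : Set A) ∈ l

/-- The Gelfand spectrum `σ(M)`: nonzero multiplicative functionals with the weak* topology. -/
abbrev Spectrum (M : AbelianCStarSubalgebra A) : Type _ :=
  WeakDual.characterSpace ℂ M.toSubalgebra

/-- `C*(h)`, the C*-subalgebra (unit not adjoined) generated by a self-adjoint element `h`. -/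
def generatedBy (h : A) (hh : IsSelfAdjoint h) : AbelianCStarSubalgebra A where
  toSubalgebra := NonUnitalStarAlgebra.elemental ℂ h
  isClosed := NonUnitalStarAlgebra.elemental.isClosed ℂ h
  mul_comm a ha b hb := by
    have : IsStarNormal h := hh.isStarNormal
    have key := _root_.mul_comm (⟨a, ha⟩ : NonUnitalStarAlgebra.elemental ℂ h) ⟨b, hb⟩
    exact congrArg Subtype.val key

variable (A) in
/-- The scalars `ℂ 1`. -/
def scalars : AbelianCStarSubalgebra A where
  toSubalgebra :=
    { carrier := Set.range fun z : ℂ => z • (1 : A)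
      add_mem' := by
        rintro _ _ ⟨z, rfl⟩ ⟨w, rfl⟩
        exact ⟨z + w, add_smul z w 1⟩
      zero_mem' := ⟨0, zero_smul ℂ 1⟩
      mul_mem' := by
        rintro _ _ ⟨z, rfl⟩ ⟨w, rfl⟩
        exact ⟨z * w, by simp [smul_smul, _root_.mul_comm]⟩
      smul_mem' := by
        rintro c _ ⟨z, rfl⟩
        exact ⟨c * z, mul_smul c z 1⟩
      star_mem' := by
        rintro _ ⟨z, rfl⟩
        exact ⟨star z, by simp⟩ }
  isClosed := by
    have e : (Set.range fun z : ℂ => z • (1 : A)) = (Submodule.span ℂ {(1 : A)} : Set A) := by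
      ext a
      simp [Submodule.mem_span_singleton]
    change IsClosed (Set.range fun z : ℂ => z • (1 : A))
    rw [e]
    exact Submodule.closed_of_finiteDimensional _
  mul_comm := by
    rintro _ ⟨z, rfl⟩ _ ⟨w, rfl⟩
    simp [smul_smul, _root_.mul_comm]

end AbelianCStarSubalgebra

/-! ### The bidual `A**` with its (Arens) product -/

section Bidual

variable {A : Type*} [CStarAlgebra A]

/-- The bidual `A**`. -/
abbrev Bidual (A : Type*) [CStarAlgebra A] : Type _ := StrongDual ℂ (StrongDual ℂ A)

/-- The product of the enveloping von Neumann algebra `A**`, i.e. the Arens product: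
`(F G)(φ) = F (a ↦ G (b ↦ φ (a b)))`. -/
def bidualMul (F G : Bidual A) : Bidual A :=
  F.comp ((ContinuousLinearMap.compL ℂ A (StrongDual ℂ A) ℂ G).comp
    (((ContinuousLinearMap.compL ℂ A (A →L[ℂ] A) (StrongDual ℂ A)).flip
      (ContinuousLinearMap.mul ℂ A)).comp (ContinuousLinearMap.compL ℂ A A ℂ)))

/-- On elements of `A` the product of `A**` is the product of `A`. -/
theorem bidualMul_inclusion (a b : A) :
    bidualMul (NormedSpace.inclusionInDoubleDual ℂ A a)
      (NormedSpace.inclusionInDoubleDual ℂ A b)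
      = NormedSpace.inclusionInDoubleDual ℂ A (a * b) := rfl

end Bidual

/-! ### Indicator functions of compact subsets of `σ(M)` as elements of `A**` -/

section Indicator

variable {A : Type*} [CStarAlgebra A] [PartialOrder A] [StarOrderedRing A]

/-- A bounded increasing net of positive elements converges against every functional. -/
theorem exists_tendsto_of_monotone {X : Type*} [Preorder X] [IsDirected X (· ≤ ·)] [Nonempty X]
    (g : X → A) (hg : Monotone g) (h0 : ∀ x, 0 ≤ g x) (h1 : ∀ x, g x ≤ 1)
    (ψ : StrongDual ℂ A) : ∃ z : ℂ, Tendsto (fun x => ψ (g x)) atTop (𝓝 z) := by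
  have real : ∀ ρ : A →L[ℝ] ℝ, ∃ r : ℝ, Tendsto (fun x => ρ (g x)) atTop (𝓝 r) := by
    intro ρ
    have hC : CauchySeq (fun x => ρ (g x)) := by
      by_contra hcon
      obtain ⟨ε, hε, H⟩ : ∃ ε > 0, ∀ x, ∃ y ≥ x, ε ≤ |ρ (g y) - ρ (g x)| := by
        by_contra! hno
        apply hcon
        refine Metric.cauchy_iff.2 ⟨map_neBot, fun ε hε => ?_⟩
        obtain ⟨x, hx⟩ := hno (ε / 2) (half_pos hε)
        refine ⟨_, image_mem_map (Ici_mem_atTop x), ?_⟩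
        rintro _ ⟨y, hy, rfl⟩ _ ⟨z, hz, rfl⟩
        rw [Real.dist_eq]
        have hy' := abs_lt.1 (hx y hy)
        have hz' := abs_lt.1 (hx z hz)
        exact abs_lt.2 ⟨by linarith [hy'.1, hz'.2], by linarith [hy'.2, hz'.1]⟩
      have step : ∀ n : ℕ, ∀ x, ∃ y ≥ x, ∃ d : A, -(g y - g x) ≤ d ∧ d ≤ g y - g x ∧
          n * ε ≤ ρ d := by
        intro n
        induction n with
        | zero => exact fun x => ⟨x, le_rfl, 0, by simp⟩
        | succ n ih =>
          intro x
          obtain ⟨y, hy, d, hd1, hd2, hd3⟩ := ih x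
          obtain ⟨z, hz, hz2⟩ := H y
          have hp : 0 ≤ g z - g y := sub_nonneg.2 (hg hz)
          have hpn : -(g z - g y) ≤ g z - g y := (neg_nonpos.2 hp).trans hp
          have e : g z - g x = (g y - g x) + (g z - g y) := by abel
          refine ⟨z, le_trans hy hz, ?_⟩
          rcases le_abs'.1 hz2 with h | h
          · refine ⟨d + -(g z - g y), ?_, ?_, ?_⟩
            · rw [e, neg_add]
              exact add_le_add hd1 le_rfl
            · rw [e]
              exact add_le_add hd2 hpn
            · rw [map_add, map_neg, map_sub]
              push_cast
              linarith
          · refine ⟨d + (g z - g y), ?_, ?_, ?_⟩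
            · rw [e, neg_add]
              exact add_le_add hd1 hpn
            · rw [e]
              exact add_le_add hd2 le_rfl
            · rw [map_add, map_sub]
              push_cast
              linarith
      have bound : ∀ n : ℕ, n * ε ≤ ‖ρ‖ * (2 * ‖(1 : A)‖ + ‖(1 : A)‖) := by
        intro n
        obtain ⟨y, hy, d, hd1, hd2, hd3⟩ := step n (Classical.arbitrary X)
        set p := g y - g (Classical.arbitrary X)
        have hp1 : p ≤ 1 := (sub_le_self _ (h0 _)).trans (h1 y)
        have hp0 : 0 ≤ p := sub_nonneg.2 (hg hy)
        have hn1 : ‖p‖ ≤ ‖(1 : A)‖ := CStarAlgebra.norm_le_norm_of_nonneg_of_le hp0 hp1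
        have hn2 : ‖d + p‖ ≤ ‖(1 : A) + 1‖ := by
          refine CStarAlgebra.norm_le_norm_of_nonneg_of_le ?_ (add_le_add (hd2.trans hp1) hp1)
          simpa using add_le_add hd1 (le_refl p)
        have hn3 : ‖(1 : A) + 1‖ ≤ 2 * ‖(1 : A)‖ := by
          linarith [norm_add_le (1 : A) 1]
        have hn4 : ‖d‖ ≤ ‖d + p‖ + ‖p‖ := by
          simpa using norm_sub_le (d + p) p
        calc n * ε ≤ ρ d := hd3
          _ ≤ ‖ρ d‖ := le_abs_self _
          _ ≤ ‖ρ‖ * ‖d‖ := ρ.le_opNorm d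
          _ ≤ _ := by gcongr; linarith
      obtain ⟨n, hn⟩ := exists_nat_gt ((‖ρ‖ * (2 * ‖(1 : A)‖ + ‖(1 : A)‖)) / ε)
      rw [div_lt_iff₀ hε] at hn
      exact absurd (bound n) (not_le.2 hn)
    exact cauchySeq_tendsto_of_complete hC
  obtain ⟨r, hr⟩ := real (Complex.reCLM.comp (ψ.restrictScalars ℝ))
  obtain ⟨s, hs⟩ := real (Complex.imCLM.comp (ψ.restrictScalars ℝ))
  refine ⟨(r : ℂ) + s * Complex.I, ?_⟩
  have h := ((Complex.continuous_ofReal.tendsto r).comp hr).add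
    (((Complex.continuous_ofReal.tendsto s).comp hs).mul_const Complex.I)
  refine h.congr fun x => ?_
  simp [Complex.re_add_im]

variable (M : AbelianCStarSubalgebra A) (K : Set M.Spectrum)

/-- The elements `0 ≤ g ≤ 1` of `M ≅ C₀(σ(M))` that vanish on `K`. -/
def vanishingOn : Set A :=
  {g | 0 ≤ g ∧ g ≤ 1 ∧ ∃ hg : g ∈ M.toSubalgebra, ∀ χ ∈ K, χ ⟨g, hg⟩ = 0}

instance : Nonempty (vanishingOn M K) :=
  ⟨⟨0, le_rfl, zero_le_one, zero_mem _, fun χ _ => map_zero χ⟩⟩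

/-- These elements are directed upwards: `f, g ≤ f + g - f g`. -/
instance : IsDirected (vanishingOn M K) (· ≤ ·) where
  directed := by
    rintro ⟨f, f0, f1, hf, fK⟩ ⟨g, g0, g1, hg, gK⟩
    have c : Commute f g := M.mul_comm f hf g hg
    have f1' : 0 ≤ 1 - f := sub_nonneg.2 f1
    have g1' : 0 ≤ 1 - g := sub_nonneg.2 g1
    have cf : Commute (1 - f) g := (Commute.one_left g).sub_left c
    have cg : Commute f (1 - g) := (Commute.one_right f).sub_right c
    have cfg : Commute (1 - f) (1 - g) := (Commute.one_right _).sub_right cf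
    have hfle : f ≤ f + g - f * g := by
      have := cf.mul_nonneg f1' g0
      rw [sub_mul, one_mul] at this
      rw [add_sub_assoc]
      exact le_add_of_nonneg_right this
    have hgle : g ≤ f + g - f * g := by
      have := cg.mul_nonneg f0 g1'
      rw [mul_sub, mul_one] at this
      rw [add_comm f g, add_sub_assoc]
      exact le_add_of_nonneg_right this
    have hle : f + g - f * g ≤ 1 := by
      have := cfg.mul_nonneg f1' g1'
      have e : (1 - f) * (1 - g) = 1 - (f + g - f * g) := by noncomm_ring
      rw [e] at this
      exact sub_nonneg.1 this
    refine ⟨⟨f + g - f * g, f0.trans hfle, hle, sub_mem (add_mem hf hg) (mul_mem hf hg), ?_⟩,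
      hfle, hgle⟩
    intro χ hχ
    have e : (⟨f + g - f * g, sub_mem (add_mem hf hg) (mul_mem hf hg)⟩ : M.toSubalgebra)
        = ⟨f, hf⟩ + ⟨g, hg⟩ - ⟨f, hf⟩ * ⟨g, hg⟩ := rfl
    rw [e, map_sub, map_add, map_mul, fK χ hχ, gK χ hχ]
    simp

theorem tendsto_vanishingOn (ψ : StrongDual ℂ A) :
    Tendsto (fun g : vanishingOn M K => ψ g) atTop
      (𝓝 (limUnder atTop fun g : vanishingOn M K => ψ g)) :=
  tendsto_nhds_limUnder (exists_tendsto_of_monotone (fun g : vanishingOn M K => (g : A))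
    (fun _ _ h => h) (fun g => g.2.1) (fun g => g.2.2.1) ψ)

/-- For closed `K`, the indicator function of the open set `σ(M) ∖ K` as an element of
`M** ⊆ A**`: the supremum (weak* limit in `A**`) of the increasing net of all `g ∈ M` with
`0 ≤ g ≤ 1` and `g = 0` on `K`. On a positive functional `φ` its value is `[φ]_M(σ(M) ∖ K)`,
where `[φ]_M` is the Radon measure on `σ(M)` representing the restriction of `φ` to `M`. -/
def indicatorCompl : Bidual A :=
  LinearMap.mkContinuous
    { toFun := fun ψ => limUnder atTop fun g : vanishingOn M K => ψ g
      map_add' := fun ψ ψ' => tendsto_nhds_unique (tendsto_vanishingOn M K (ψ + ψ'))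
        ((tendsto_vanishingOn M K ψ).add (tendsto_vanishingOn M K ψ'))
      map_smul' := fun c ψ => tendsto_nhds_unique (tendsto_vanishingOn M K (c • ψ))
        ((tendsto_vanishingOn M K ψ).const_mul c) }
    ‖(1 : A)‖ fun ψ => by
      refine le_of_tendsto (tendsto_vanishingOn M K ψ).norm (Eventually.of_forall fun g => ?_)
      rw [_root_.mul_comm]
      exact (ψ.le_opNorm _).trans (mul_le_mul_of_nonneg_left
        (CStarAlgebra.norm_le_norm_of_nonneg_of_le g.2.1 g.2.2.1) (norm_nonneg _))

/-- The indicator function `1_K ∈ M** ⊆ A**` of a closed set `K ⊆ σ(M)`. Since `M` contains an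
approximate identity of `A`, the function `1` on `σ(M)` is the unit of `A**`; thus
`1_K = 1 - 1_{σ(M) ∖ K}`. -/
def indicator : Bidual A :=
  NormedSpace.inclusionInDoubleDual ℂ A 1 - indicatorCompl M K

end Indicator

/-! ### States -/

section States

variable (A : Type*) [CStarAlgebra A] [PartialOrder A] [StarOrderedRing A]

/-- The state space of `A` (positive linear functionals of norm one). As a subset of the weak
dual, it carries the weak* topology. -/
abbrev StateSpace : Type _ :=
  {φ : WeakDual ℂ A // (∀ a : A, 0 ≤ a → 0 ≤ φ a) ∧ ‖WeakDual.toStrongDual φ‖ = 1}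

variable {A}

/-- A state of `A`, as an element of the Banach space dual of `A`. -/
def StateSpace.toDual (φ : StateSpace A) : StrongDual ℂ A := WeakDual.toStrongDual φ.1

/-- `S(A|K)`: the states `φ` with `φ(1_K) = 1`. -/
def statesOn (M : AbelianCStarSubalgebra A) (K : Compacts M.Spectrum) : Set (StateSpace A) :=
  {φ | indicator M (K : Set M.Spectrum) φ.toDual = 1}

/-- The local state space `S(A|M)`. -/
def localStates (M : AbelianCStarSubalgebra A) : Set (StateSpace A) :=
  ⋃ K : Compacts M.Spectrum, statesOn M K

/-- Strictly positive elements: `h ≥ 0` and `φ(h) > 0` for every state `φ`. -/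
def StrictlyPositive (h : A) : Prop :=
  0 ≤ h ∧ ∀ φ : StateSpace A, 0 < φ.1 h

theorem StrictlyPositive.isSelfAdjoint {h : A} (hh : StrictlyPositive h) : IsSelfAdjoint h :=
  IsSelfAdjoint.of_nonneg hh.1

/-- `C*(h)` for strictly positive `h`. -/
def StrictlyPositive.algebra {h : A} (hh : StrictlyPositive h) : AbelianCStarSubalgebra A :=
  AbelianCStarSubalgebra.generatedBy h hh.isSelfAdjoint

end States

/-! ### Lipschitz pairs -/

/-- `(A, L)` is a Lipschitz pair, for unital `A`: `L` is a seminorm on a dense real subspace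
`dom` of the self-adjoint part of `A`, and the set of self-adjoint `a` with `L a = 0` is `ℝ 1`. -/
structure LipschitzPair (A : Type*) [CStarAlgebra A] where
  dom : Submodule ℝ (selfAdjoint A)
  dense_dom : Dense (dom : Set (selfAdjoint A))
  L : Seminorm ℝ dom
  ker_eq : {a : selfAdjoint A | ∃ h : a ∈ dom, L ⟨a, h⟩ = 0}
    = {a : selfAdjoint A | ∃ r : ℝ, a = r • (1 : selfAdjoint A)}

namespace LipschitzPair

variable {A : Type*} [CStarAlgebra A]

/-- The Lipschitz ball: all self-adjoint `a` with `L a ≤ 1`, as a subset of `A`. -/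
def ball (P : LipschitzPair A) : Set A :=
  {a | ∃ b : P.dom, P.L b ≤ 1 ∧ ((b : selfAdjoint A) : A) = a}

variable [PartialOrder A] [StarOrderedRing A]

/-- All self-adjoint `a` with `L a ≤ 1` and `μ a = 0`. -/
def ballAt (P : LipschitzPair A) (μ : StateSpace A) : Set A :=
  {a ∈ P.ball | μ.1 a = 0}

/-- The extended Monge-Kantorovich metric `sup {|φ a - ψ a| : a self-adjoint, L a ≤ 1}`. -/
def mkDist (P : LipschitzPair A) (φ ψ : StateSpace A) : ℝ≥0∞ :=
  ⨆ a ∈ P.ball, ‖φ.1 a - ψ.1 a‖ₑ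

/-- The state space with the extended Monge-Kantorovich metric as its distance. -/
@[reducible] def mkMetric (P : LipschitzPair A) : PseudoEMetricSpace (StateSpace A) where
  edist := P.mkDist
  edist_self φ := by simp [mkDist]
  edist_comm φ ψ := by simp only [mkDist, enorm_sub_rev]
  edist_triangle φ ψ θ := by
    refine iSup₂_le fun a ha => ?_
    have e : φ.1 a - θ.1 a = (φ.1 a - ψ.1 a) + (ψ.1 a - θ.1 a) := by ring
    rw [e]
    refine (enorm_add_le _ _).trans (add_le_add ?_ ?_)
    · exact le_iSup₂ (f := fun a (_ : a ∈ P.ball) => ‖φ.1 a - ψ.1 a‖ₑ) a ha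
    · exact le_iSup₂ (f := fun a (_ : a ∈ P.ball) => ‖ψ.1 a - θ.1 a‖ₑ) a ha

/-- The topology induced by the extended Monge-Kantorovich metric. -/
@[reducible] def mkTopology (P : LipschitzPair A) : TopologicalSpace (StateSpace A) :=
  P.mkMetric.toUniformSpace.toTopologicalSpace

/-- The diameter of a set of states for the extended Monge-Kantorovich metric. -/
def mkDiam (P : LipschitzPair A) (S : Set (StateSpace A)) : ℝ≥0∞ :=
  ⨆ φ ∈ S, ⨆ ψ ∈ S, P.mkDist φ ψ

/-- `(A, L)` is a compact quantum metric space in the sense of Rieffel, for the order unit space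
of the self-adjoint elements of `A`: `L` vanishes exactly on the scalars, the state space has
finite diameter, and `{a : L a ≤ 1}` has totally bounded image in the quotient normed space of `A`
by the scalars. -/
def IsCompactQuantumMetricSpace (P : LipschitzPair A) : Prop :=
  (∀ a : P.dom, P.L a = 0 ↔ ∃ r : ℝ, (a : selfAdjoint A) = r • (1 : selfAdjoint A)) ∧
  P.mkDiam Set.univ < ⊤ ∧
  TotallyBounded ((Submodule.span ℂ {(1 : A)}).mkQ '' P.ball)

/-- `(A, L, M)` is a Lipschitz triple. -/
def IsLipschitzTriple (_P : LipschitzPair A) (M : AbelianCStarSubalgebra A) : Prop :=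
  M.IsTopography

/-- Tame sets of states: for some local state `μ`, the supremum of `|φ (a - 1_K a 1_K)|` over
all `φ` in the set and all self-adjoint `a` with `L a ≤ 1` and `μ a = 0` tends to `0` along the
compact sets `K ⊆ σ(M)` directed by inclusion. Here `φ` is evaluated on `A**`. -/
def IsTame (P : LipschitzPair A) (M : AbelianCStarSubalgebra A) (S : Set (StateSpace A)) : Prop :=
  ∃ μ ∈ localStates M, Tendsto (fun K : Compacts M.Spectrum =>
    ⨆ a ∈ P.ballAt μ, ⨆ φ ∈ S,
      ‖(NormedSpace.inclusionInDoubleDual ℂ A a -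
        bidualMul (bidualMul (indicator M (K : Set M.Spectrum))
          (NormedSpace.inclusionInDoubleDual ℂ A a)) (indicator M (K : Set M.Spectrum)))
        φ.toDual‖ₑ) atTop (𝓝 0)

/-- Regularity: each `S(A|K)`, `K ⊆ σ(M)` compact, has finite diameter. -/
def IsRegular (P : LipschitzPair A) (M : AbelianCStarSubalgebra A) : Prop :=
  ∀ K : Compacts M.Spectrum, P.mkDiam (statesOn M K) < ⊤

/-- `(A, L, M)` is a quantum locally compact metric space: a regular Lipschitz triple such that
on every tame set the extended Monge-Kantorovich metric induces the relative weak* topology. -/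
def IsQuantumLocallyCompact (P : LipschitzPair A) (M : AbelianCStarSubalgebra A) : Prop :=
  P.IsLipschitzTriple M ∧ P.IsRegular M ∧
  ∀ S : Set (StateSpace A), P.IsTame M S →
    P.mkTopology.induced (Subtype.val : S → StateSpace A) =
      (instTopologicalSpaceSubtype : TopologicalSpace S)

/-- `(A, L, M)` is a quantum locally compact separable metric space. -/
def IsQuantumLocallyCompactSeparable (P : LipschitzPair A) (M : AbelianCStarSubalgebra A) :
    Prop :=
  P.IsQuantumLocallyCompact M ∧ SeparableSpace A

end LipschitzPair

end QuantumMetric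

end

open Filter Topology Set TopologicalSpace
open scoped ComplexOrder ENNReal

noncomputable section

namespace QuantumMetric

/-! ### Positive functionals and states. -/

section PositiveFunctionals

variable {A : Type*} [CStarAlgebra A] [PartialOrder A] [StarOrderedRing A]

/-! In a unital algebra local compactness degenerates to compactness. An approximate identity
converges in norm to `1`, so a closed subalgebra containing one contains `1`. Then `σ(M)` is itself
compact, `1_K = 1` for `K = σ(M)`, every state lies in `S(A|K)`, and the whole state space is tame
because the limit is taken along a directed set with a greatest element. The locally compact axioms
for any single `M` thus say that the state space has finite diameter and that the Monge-Kantorovich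
metric induces the weak* topology. It remains to prove Rieffel's characterization: given finite
diameter, this happens exactly when the Lipschitz ball is totally bounded modulo scalars.
`mkTopology_eq_of_totallyBounded` uses finite nets and compactness of the state space;
`totallyBounded_of_mkTopology_eq` uses Arzelà-Ascoli on the state space, where states control the
norm (`norm_le_of_forall_state`). Total boundedness also yields separability. Conditions 5 and 6
fall under the same argument because a strictly positive `h` is bounded below, so `C*(h)` contains
`1`. -/

/-- Cauchy-Schwarz for the GNS form `⟨x, y⟩ = ψ (star x * y)` at the vectors `1` and `a`. For
positive functionals it makes norm one equivalent to value one at the unit. -/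
theorem norm_apply_le_of_positive (ψ : StrongDual ℂ A) (hψ : ∀ a : A, 0 ≤ a → 0 ≤ ψ a) (a : A) :
    ‖ψ a‖ ≤ ‖ψ 1‖ * ‖a‖ := by
  let f : A →ₚ[ℂ] ℂ := PositiveLinearMap.mk₀ (ψ : A →ₗ[ℂ] ℂ) hψ
  have hf : ∀ x, f x = ψ x := fun _ => rfl
  have hsq : ∀ x : A, ‖f.toPreGNS x‖ ^ 2 = ‖ψ (star x * x)‖ := by
    intro x
    have h := f.preGNS_norm_sq (f.toPreGNS x)
    rw [f.ofPreGNS_toPreGNS, hf] at h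
    rw [← h]
    simp
  have hinner : ‖ψ a‖ ≤ ‖f.toPreGNS 1‖ * ‖f.toPreGNS a‖ := by
    have h := norm_inner_le_norm (𝕜 := ℂ) (f.toPreGNS 1) (f.toPreGNS a)
    rw [f.preGNS_inner_def, f.ofPreGNS_toPreGNS, f.ofPreGNS_toPreGNS, star_one, one_mul, hf] at h
    exact h
  have h1 : ‖f.toPreGNS 1‖ ^ 2 = ‖ψ 1‖ := by simpa using hsq 1
  have h2 : ‖f.toPreGNS a‖ ^ 2 ≤ ‖ψ 1‖ * ‖a‖ ^ 2 := by
    rw [hsq]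
    have h := f.norm_apply_le_of_nonneg (star a * a) (star_mul_self_nonneg a)
    rw [hf, hf, CStarRing.norm_star_mul_self, ← sq] at h
    exact h
  refine le_of_sq_le_sq ?_ (by positivity)
  calc ‖ψ a‖ ^ 2 ≤ (‖f.toPreGNS 1‖ * ‖f.toPreGNS a‖) ^ 2 := by gcongr
    _ = ‖ψ 1‖ * ‖f.toPreGNS a‖ ^ 2 := by rw [mul_pow, h1]
    _ ≤ ‖ψ 1‖ * (‖ψ 1‖ * ‖a‖ ^ 2) := by gcongr
    _ = (‖ψ 1‖ * ‖a‖) ^ 2 := by ring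

/-- A positive functional with value one at the unit is a state. -/
def StateSpace.ofPositive [Nontrivial A] (ψ : StrongDual ℂ A) (hψ : ∀ a : A, 0 ≤ a → 0 ≤ ψ a)
    (h1 : ψ 1 = 1) : StateSpace A :=
  ⟨StrongDual.toWeakDual ψ, hψ, le_antisymm
    (ψ.opNorm_le_bound zero_le_one fun a => by
      simpa [h1] using norm_apply_le_of_positive ψ hψ a)
    (by simpa [h1] using ψ.le_opNorm 1)⟩

omit [StarOrderedRing A] in
theorem StateSpace.norm_apply_le (φ : StateSpace A) (a : A) : ‖φ.1 a‖ ≤ ‖a‖ := by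
  have h := (WeakDual.toStrongDual φ.1).le_opNorm a
  rw [φ.2.2, one_mul] at h
  exact h

omit [StarOrderedRing A] in
theorem StateSpace.nontrivial (φ : StateSpace A) : Nontrivial A := by
  by_contra hA
  rw [not_nontrivial_iff_subsingleton] at hA
  have h : ‖WeakDual.toStrongDual φ.1‖ ≤ 0 :=
    ContinuousLinearMap.opNorm_le_bound _ le_rfl fun a => by
      simp [Subsingleton.elim a 0]
  rw [φ.2.2] at h
  linarith

@[simp]
theorem StateSpace.map_one (φ : StateSpace A) : φ.1 (1 : A) = 1 := by
  have := φ.nontrivial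
  have hp : 0 ≤ φ.1 (1 : A) := φ.2.1 1 zero_le_one
  have hn : ‖φ.1 (1 : A)‖ = 1 := by
    refine le_antisymm (by simpa using φ.norm_apply_le 1) ?_
    have h := (WeakDual.toStrongDual φ.1).opNorm_le_bound (norm_nonneg _)
      (norm_apply_le_of_positive (WeakDual.toStrongDual φ.1) φ.2.1)
    rwa [φ.2.2] at h
  rw [Complex.eq_coe_norm_of_nonneg hp, hn, Complex.ofReal_one]

theorem StateSpace.ofReal_re_apply (φ : StateSpace A) {a : A} (ha : IsSelfAdjoint a) :
    ((φ.1 a).re : ℂ) = φ.1 a := by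
  let f : A →ₚ[ℂ] ℂ := PositiveLinearMap.mk₀ (WeakDual.toStrongDual φ.1 : A →ₗ[ℂ] ℂ) φ.2.1
  have h : IsSelfAdjoint (φ.1 a) := ha.map f
  exact Complex.conj_eq_iff_re.1 h

/-- The state space is weak* compact. -/
instance : CompactSpace (StateSpace A) := by
  rcases subsingleton_or_nontrivial A with hA | hA
  · have : IsEmpty (StateSpace A) := ⟨fun φ => not_nontrivial A φ.nontrivial⟩
    infer_instance
  have hc : IsCompact
      {φ : WeakDual ℂ A | (∀ a : A, 0 ≤ a → 0 ≤ φ a) ∧ ‖WeakDual.toStrongDual φ‖ = 1} := by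
    refine (WeakDual.isCompact_closedBall (𝕜 := ℂ) (0 : StrongDual ℂ A) 1).of_isClosed_subset
      ?_ fun φ hφ => by simpa using hφ.2.le
    -- The unit sphere is not weak* closed in general, but on positive functionals it is cut out by
    -- the closed condition `φ 1 = 1`.
    have e : {φ : WeakDual ℂ A | (∀ a : A, 0 ≤ a → 0 ≤ φ a) ∧ ‖WeakDual.toStrongDual φ‖ = 1}
        = (⋂ a : A, ⋂ _ : 0 ≤ a, {φ : WeakDual ℂ A | 0 ≤ φ a}) ∩
          {φ : WeakDual ℂ A | φ 1 = 1} := by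
      ext φ
      simp only [mem_ofPred_eq, mem_inter_iff, mem_iInter]
      refine ⟨fun h => ⟨h.1, StateSpace.map_one ⟨φ, h⟩⟩, fun h => ⟨h.1, ?_⟩⟩
      exact (StateSpace.ofPositive (WeakDual.toStrongDual φ) h.1 h.2).2.2
    rw [e]
    refine IsClosed.inter (isClosed_iInter fun a => isClosed_iInter fun _ => ?_) ?_
    · exact isClosed_le continuous_const (WeakDual.eval_continuous a)
    · exact isClosed_eq (WeakDual.eval_continuous 1) continuous_const
  exact isCompact_iff_compactSpace.1 hc

/-- A self-adjoint element on which every state is nonnegative is positive. -/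
theorem nonneg_of_forall_state {a : A} (ha : IsSelfAdjoint a)
    (h : ∀ φ : StateSpace A, 0 ≤ φ.1 a) : 0 ≤ a := by
  by_contra hcon
  have hA : Nontrivial A := ⟨⟨a, 0, fun h0 => hcon h0.ge⟩⟩
  let C : ProperCone ℝ A :=
    { PointedCone.positive ℝ A with
      isClosed' := CStarAlgebra.isClosed_nonneg }
  obtain ⟨f, hf, hfa⟩ := C.hyperplane_separation_point (x₀ := a) hcon
  -- Precomposing the separating functional with the real-part projection makes its complexification
  -- real on self-adjoint elements, where it equals `f`.
  let re : A →L[ℝ] A :=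
    (2⁻¹ : ℝ) • (ContinuousLinearMap.id ℝ A + ((starL' ℝ : A ≃L[ℝ] A) : A →L[ℝ] A))
  have hre : ∀ x : A, re x = (2⁻¹ : ℝ) • (x + star x) := fun _ => rfl
  have hre_sa : ∀ x : A, IsSelfAdjoint x → re x = x := by
    intro x hx
    rw [hre, hx.star_eq, ← two_smul ℝ x, smul_smul]
    norm_num
  have hre_I : ∀ x : A, IsSelfAdjoint x → re (Complex.I • x) = 0 := by
    intro x hx
    rw [hre, star_smul, hx.star_eq]
    simp
  let ψ : StrongDual ℂ A := StrongDual.extendRCLike (f.comp re)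
  have hψ : ∀ x : A, IsSelfAdjoint x → ψ x = (f x : ℂ) := by
    intro x hx
    have e : ψ x = (f (re x) : ℂ) - Complex.I * (f (re (Complex.I • x)) : ℂ) := rfl
    rw [e, hre_sa x hx, hre_I x hx]
    simp
  have hpos : ∀ x : A, 0 ≤ x → 0 ≤ ψ x := by
    intro x hx
    rw [hψ x (.of_nonneg hx)]
    exact_mod_cast hf x hx
  -- If `f 1 = 0`, the positive functional `ψ` vanishes, contradicting `f a < 0`; so `ψ` can be
  -- normalized to a state.
  have h1 : 0 < f 1 := by
    refine lt_of_le_of_ne (hf 1 (zero_le_one : (0 : A) ≤ 1)) fun h0 => ?_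
    have hn := norm_apply_le_of_positive ψ hpos a
    rw [hψ 1 (.one A), ← h0, hψ a ha] at hn
    simp at hn
    exact hfa.ne hn
  have key := h (StateSpace.ofPositive (((f 1)⁻¹ : ℂ) • ψ)
    (fun x hx => mul_nonneg (inv_nonneg.2 (by exact_mod_cast h1.le)) (hpos x hx))
    (by
      change ((f 1 : ℂ))⁻¹ * ψ 1 = 1
      rw [hψ 1 (.one A)]
      exact inv_mul_cancel₀ (by exact_mod_cast h1.ne')))
  change 0 ≤ ((f 1 : ℂ))⁻¹ * ψ a at key
  rw [hψ a ha] at key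
  have key' : (0 : ℝ) ≤ (f 1)⁻¹ * f a := by exact_mod_cast key
  exact absurd key' (not_le.2 (mul_neg_of_pos_of_neg (inv_pos.2 h1) hfa))

/-- States control the norm of self-adjoint elements. -/
theorem norm_le_of_forall_state {a : A} (ha : IsSelfAdjoint a) {c : ℝ}
    (h : ∀ φ : StateSpace A, ‖φ.1 a‖ ≤ c) (hc : 0 ≤ c) : ‖a‖ ≤ 3 * c := by
  rcases subsingleton_or_nontrivial A with hA | hA
  · rw [Subsingleton.elim a 0, norm_zero]
    positivity
  have hc1 : IsSelfAdjoint ((c : ℂ) • (1 : A)) := by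
    simp [IsSelfAdjoint]
  have key : ∀ b : A, IsSelfAdjoint b → (∀ φ : StateSpace A, ‖φ.1 b‖ ≤ c) →
      0 ≤ b + (c : ℂ) • (1 : A) := by
    intro b hb hbc
    refine nonneg_of_forall_state (hb.add hc1) fun φ => ?_
    rw [map_add, map_smul, φ.map_one, ← φ.ofReal_re_apply hb, smul_eq_mul, mul_one]
    have h1 := (abs_le.1 ((Complex.abs_re_le_norm _).trans (hbc φ))).1
    have h2 : 0 ≤ (φ.1 b).re + c := by linarith
    exact_mod_cast h2
  have hp := key a ha h
  have hm := key (-a) ha.neg fun φ => by simpa using h φ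
  -- From `0 ≤ a + c ≤ 2c` the norm of `a + c` is at most `2c`; removing `c` costs another `c`,
  -- hence the 3. Any constant would serve.
  have hle : a + (c : ℂ) • (1 : A) ≤ (c : ℂ) • (1 : A) + (c : ℂ) • (1 : A) := by
    refine add_le_add ?_ le_rfl
    rw [← sub_nonneg]
    simpa [add_comm, sub_eq_add_neg] using hm
  have hn := CStarAlgebra.norm_le_norm_of_nonneg_of_le hp hle
  have hn1 : ‖(c : ℂ) • (1 : A)‖ = c := by
    rw [norm_smul, CStarRing.norm_one, mul_one, Complex.norm_real, Real.norm_of_nonneg hc]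
  have h3 : ‖a‖ ≤ ‖a + (c : ℂ) • (1 : A)‖ + ‖(c : ℂ) • (1 : A)‖ := by
    simpa using norm_sub_le (a + (c : ℂ) • (1 : A)) ((c : ℂ) • (1 : A))
  have h4 := norm_add_le ((c : ℂ) • (1 : A)) ((c : ℂ) • (1 : A))
  linarith

end PositiveFunctionals

/-! ### Topographies, spectra and strictly positive elements. -/

section Subalgebras

variable {A : Type*} [CStarAlgebra A] (M : AbelianCStarSubalgebra A)

theorem AbelianCStarSubalgebra.isTopography_iff_one_mem :
    M.IsTopography ↔ (1 : A) ∈ M.toSubalgebra := by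
  constructor
  · rintro ⟨l, hl, hM⟩
    have := hl.neBot
    have h1 : Tendsto (fun x : A => x) l (𝓝 1) := by simpa using hl.tendsto_mul_left 1
    exact M.isClosed.mem_of_tendsto h1 hM
  · exact fun h => ⟨pure 1, .pure_one A, h⟩

/-- An Abelian C*-subalgebra that contains the unit, as a unital `*`-subalgebra. -/
def AbelianCStarSubalgebra.toStarSubalgebra (h1 : (1 : A) ∈ M.toSubalgebra) :
    StarSubalgebra ℂ A where
  carrier := M.toSubalgebra
  mul_mem' := mul_mem
  add_mem' := add_mem
  star_mem' := star_mem
  algebraMap_mem' r := by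
    rw [Algebra.algebraMap_eq_smul_one]
    exact SMulMemClass.smul_mem r h1

/-- The C*-algebra structure of an Abelian C*-subalgebra that contains the unit. -/
@[reducible]
def AbelianCStarSubalgebra.commCStarAlgebra (h1 : (1 : A) ∈ M.toSubalgebra) :
    CommCStarAlgebra (M.toStarSubalgebra h1) :=
  { StarSubalgebra.cstarAlgebra (M.toStarSubalgebra h1) (h_closed := M.isClosed) with
    mul_comm := fun a b => Subtype.ext (M.mul_comm a a.2 b b.2) }

/-- `σ(M)` is definitionally the character space of a unital commutative C*-algebra. -/
theorem AbelianCStarSubalgebra.compactSpace_spectrum (h1 : (1 : A) ∈ M.toSubalgebra) :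
    CompactSpace M.Spectrum := by
  let := M.commCStarAlgebra h1
  exact (inferInstance : CompactSpace (WeakDual.characterSpace ℂ (M.toStarSubalgebra h1)))

theorem AbelianCStarSubalgebra.eq_zero_of_forall_character (h1 : (1 : A) ∈ M.toSubalgebra)
    {a : A} (ha : a ∈ M.toSubalgebra) (h : ∀ χ : M.Spectrum, χ ⟨a, ha⟩ = 0) : a = 0 := by
  let := M.commCStarAlgebra h1
  let b : M.toStarSubalgebra h1 := ⟨a, ha⟩
  have hb : b = 0 := by
    refine (gelfandTransform_isometry (M.toStarSubalgebra h1)).injective ?_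
    rw [map_zero]
    ext χ
    exact h χ
  exact congrArg Subtype.val hb

variable [PartialOrder A] [StarOrderedRing A]

/-- By injectivity of the Gelfand transform, only `0` vanishes on all of `σ(M)`, so the net defining
the complementary indicator is constantly zero. -/
theorem indicator_univ (h1 : (1 : A) ∈ M.toSubalgebra) :
    indicator M (univ : Set M.Spectrum) = NormedSpace.inclusionInDoubleDual ℂ A 1 := by
  have h0 : indicatorCompl M (univ : Set M.Spectrum) = 0 := by
    ext ψ
    refine tendsto_nhds_unique (tendsto_vanishingOn M univ ψ) ?_
    refine tendsto_const_nhds.congr fun g => ?_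
    obtain ⟨hg, hχ⟩ := g.2.2.2
    rw [M.eq_zero_of_forall_character h1 hg fun χ => hχ χ (mem_univ χ), map_zero]
    rfl
  rw [indicator, h0]
  exact sub_zero (G := Bidual A) _

/-- A strictly positive element is bounded below by a positive scalar. -/
theorem StrictlyPositive.exists_le {h : A} (hh : StrictlyPositive h) :
    ∃ δ : ℝ, 0 < δ ∧ algebraMap ℝ A δ ≤ h := by
  have hpos : ∀ φ : StateSpace A, 0 < (φ.1 h).re := fun φ => (Complex.lt_def.1 (hh.2 φ)).1
  obtain ⟨δ, hδ, hle⟩ : ∃ δ : ℝ, 0 < δ ∧ ∀ φ : StateSpace A, δ ≤ (φ.1 h).re := by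
    rcases isEmpty_or_nonempty (StateSpace A) with hE | hE
    · exact ⟨1, one_pos, fun φ => hE.elim φ⟩
    have hc : Continuous fun φ : StateSpace A => (φ.1 h).re :=
      Complex.continuous_re.comp ((WeakDual.eval_continuous h).comp continuous_subtype_val)
    obtain ⟨φ, -, hφ⟩ := isCompact_univ.exists_isMinOn (univ_nonempty (α := StateSpace A))
      hc.continuousOn
    exact ⟨_, hpos φ, fun ψ => hφ (mem_univ ψ)⟩
  refine ⟨δ, hδ, sub_nonneg.1 (nonneg_of_forall_state
    (hh.isSelfAdjoint.sub (.algebraMap A (.all δ))) fun φ => ?_)⟩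
  rw [map_sub, ← φ.ofReal_re_apply hh.isSelfAdjoint, Algebra.algebraMap_eq_smul_one,
    ← Complex.coe_smul, map_smul, φ.map_one, smul_eq_mul, mul_one, sub_nonneg]
  exact_mod_cast hle φ

theorem StrictlyPositive.one_mem_algebra {h : A} (hh : StrictlyPositive h) :
    (1 : A) ∈ hh.algebra.toSubalgebra := by
  obtain ⟨δ, hδ, hle⟩ := hh.exists_le
  have hsa := hh.isSelfAdjoint
  -- `f 0 = 0` keeps `f(h)` in the non-unital algebra `C*(h)`, while `f = 1` on `[δ, ∞)`, which
  -- contains the spectrum of `h`.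
  let f : ℝ → ℝ := fun x => min (x / δ) 1
  have hf : cfcₙ f h = 1 := by
    rw [cfcₙ_eq_cfc (hf := by fun_prop) (hf0 := by simp [f])]
    rw [← cfc_const_one ℝ h]
    refine cfc_congr fun x hx => ?_
    have hx' := (algebraMap_le_iff_le_spectrum hsa).1 hle x hx
    exact min_eq_right ((one_le_div hδ).2 hx')
  rw [← hf]
  have : IsClosed (hh.algebra.toSubalgebra : Set A) := hh.algebra.isClosed
  exact cfcₙ_mem (𝕜 := ℝ) (𝕜' := ℂ) (s := hh.algebra.toSubalgebra) f
    (NonUnitalStarAlgebra.elemental.self_mem ℂ h)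

theorem strictlyPositive_one : StrictlyPositive (1 : A) :=
  ⟨zero_le_one, fun φ => by rw [φ.map_one]; exact zero_lt_one⟩

end Subalgebras

/-! ### The Lipschitz ball: density and total boundedness modulo scalars. -/

namespace LipschitzPair

variable {A : Type*} [CStarAlgebra A] (P : LipschitzPair A)

theorem isSelfAdjoint_of_mem_ball {a : A} (ha : a ∈ P.ball) : IsSelfAdjoint a := by
  obtain ⟨b, -, rfl⟩ := ha
  exact (b : selfAdjoint A).2

theorem exists_smul_mem_ball (b : P.dom) :
    ∃ r : ℝ, 0 < r ∧ r • ((b : selfAdjoint A) : A) ∈ P.ball := by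
  -- The summand 1 covers the case `L b = 0`.
  have hp : 0 < 1 + P.L b := by linarith [apply_nonneg P.L b]
  refine ⟨(1 + P.L b)⁻¹, inv_pos.2 hp, (1 + P.L b)⁻¹ • b, ?_, rfl⟩
  rw [map_smul_eq_mul, Real.norm_of_nonneg (inv_nonneg.2 hp.le), inv_mul_le_one₀ hp]
  linarith

/-- A closed complex subspace that contains the Lipschitz ball is the whole algebra. -/
theorem eq_top_of_ball_subset {V : Submodule ℂ A} (hV : IsClosed (V : Set A))
    (h : P.ball ⊆ V) : V = ⊤ := by
  have hdom : ∀ b : P.dom, ((b : selfAdjoint A) : A) ∈ V := by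
    intro b
    obtain ⟨r, hr, hb⟩ := P.exists_smul_mem_ball b
    have h1 := V.smul_mem ((r : ℂ)⁻¹) (h hb)
    rwa [← Complex.coe_smul r, smul_smul, inv_mul_cancel₀ (by exact_mod_cast hr.ne'),
      one_smul] at h1
  have hsa : ∀ b : selfAdjoint A, (b : A) ∈ V := by
    intro b
    have hc : IsClosed ((fun b : selfAdjoint A => (b : A)) ⁻¹' (V : Set A)) :=
      hV.preimage continuous_subtype_val
    exact closure_minimal (fun x hx => hdom ⟨x, hx⟩) hc (P.dense_dom b)
  rw [eq_top_iff]
  intro a _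
  rw [← realPart_add_I_smul_imaginaryPart a]
  exact V.add_mem (hsa _) (V.smul_mem _ (hsa _))

/-- `L` vanishes on scalars. This allows elements of the ball to be normalized to `μ a = 0`. -/
theorem add_real_smul_one_mem_ball {a : A} (ha : a ∈ P.ball) (r : ℝ) :
    a + (r : ℂ) • (1 : A) ∈ P.ball := by
  obtain ⟨b, hb, rfl⟩ := ha
  have hk : (r • (1 : selfAdjoint A)) ∈
      {a : selfAdjoint A | ∃ h : a ∈ P.dom, P.L ⟨a, h⟩ = 0} := by
    rw [P.ker_eq]
    exact ⟨r, rfl⟩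
  obtain ⟨hd, h0⟩ := hk
  refine ⟨b + ⟨_, hd⟩, (map_add_le_add P.L _ _).trans (by rw [h0, add_zero]; exact hb), ?_⟩
  simp

/-- Total boundedness modulo the scalars, in terms of finite nets. -/
theorem exists_finite_net
    (h : TotallyBounded ((Submodule.span ℂ {(1 : A)}).mkQ '' P.ball)) {ε : ℝ} (hε : 0 < ε) :
    ∃ C ⊆ P.ball, C.Finite ∧ ∀ a ∈ P.ball, ∃ c ∈ C, ∃ z : ℂ, ‖a - c - z • (1 : A)‖ < ε := by
  obtain ⟨T, hT, hTf, hcov⟩ := totallyBounded_iff_subset.1 h _ (Metric.dist_mem_uniformity hε)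
  obtain ⟨C, hC, hCf, rfl⟩ := exists_subset_image_finite_and.1 ⟨T, hT, hTf, rfl⟩
  refine ⟨C, hC, hCf, fun a ha => ?_⟩
  have ha' := hcov (mem_image_of_mem _ ha)
  simp only [mem_iUnion, mem_image, exists_prop] at ha'
  obtain ⟨_, ⟨c, hc, rfl⟩, hd⟩ := ha'
  have hd' : ‖(Submodule.span ℂ {(1 : A)}).mkQ (a - c)‖ < ε := by
    rw [map_sub, ← dist_eq_norm]
    exact hd
  -- The quotient norm is an infimum over representatives; the strict inequality leaves room to pick
  -- one of norm below `ε`.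
  obtain ⟨m, hm, hmn⟩ := Submodule.Quotient.norm_mk_lt
    ((Submodule.span ℂ {(1 : A)}).mkQ (a - c)) (sub_pos.2 hd')
  have hmem : a - c - m ∈ Submodule.span ℂ {(1 : A)} :=
    (Submodule.Quotient.eq _).1 (show _ = _ from hm.symm)
  obtain ⟨z, hz⟩ := Submodule.mem_span_singleton.1 hmem
  refine ⟨c, hc, z, ?_⟩
  rw [hz, sub_sub_cancel]
  linarith

/-- Finite `1/(n+1)`-nets for all `n`, together with `1`, form a countable set whose closed span
contains the ball, hence everything. -/
theorem separableSpace_of_totallyBounded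
    (h : TotallyBounded ((Submodule.span ℂ {(1 : A)}).mkQ '' P.ball)) : SeparableSpace A := by
  choose C hC hCf hnet using fun n : ℕ => P.exists_finite_net h (Nat.one_div_pos_of_nat (n := n))
  let D : Set A := insert 1 (⋃ n, C n)
  have hD : D.Countable := (countable_iUnion fun n => (hCf n).countable).insert 1
  have hV : (Submodule.span ℂ D).topologicalClosure = ⊤ := by
    refine P.eq_top_of_ball_subset (Submodule.isClosed_topologicalClosure _) fun a ha => ?_
    rw [Submodule.topologicalClosure_coe, Metric.mem_closure_iff]
    intro ε hε
    obtain ⟨n, hn⟩ := exists_nat_one_div_lt hε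
    obtain ⟨c, hc, z, hz⟩ := hnet n a ha
    refine ⟨c + z • 1, Submodule.add_mem _
      (Submodule.subset_span (mem_insert_of_mem _ (mem_iUnion.2 ⟨n, hc⟩)))
      (Submodule.smul_mem _ _ (Submodule.subset_span (mem_insert _ _))), ?_⟩
    rw [dist_eq_norm, ← sub_sub]
    exact hz.trans hn
  have hs : IsSeparable (closure (Submodule.span ℂ D : Set A)) :=
    (hD.isSeparable.span (R := ℂ)).closure
  rw [← Submodule.topologicalClosure_coe, hV, Submodule.top_coe] at hs
  exact isSeparable_univ_iff.1 hs

/-! ### The Monge-Kantorovich metric against the weak* topology. -/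

variable [PartialOrder A] [StarOrderedRing A]

omit [StarOrderedRing A] in
theorem enorm_sub_le_mkDist {a : A} (ha : a ∈ P.ball) (φ ψ : StateSpace A) :
    ‖φ.1 a - ψ.1 a‖ₑ ≤ P.mkDist φ ψ :=
  le_iSup₂ (f := fun a (_ : a ∈ P.ball) => ‖φ.1 a - ψ.1 a‖ₑ) a ha

omit [StarOrderedRing A] in
theorem mkDist_le_mkDiam {S : Set (StateSpace A)} {φ ψ : StateSpace A} (hφ : φ ∈ S)
    (hψ : ψ ∈ S) : P.mkDist φ ψ ≤ P.mkDiam S :=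
  (le_iSup₂ (f := fun ψ (_ : ψ ∈ S) => P.mkDist φ ψ) ψ hψ).trans
    (le_iSup₂ (f := fun φ (_ : φ ∈ S) => ⨆ ψ ∈ S, P.mkDist φ ψ) φ hφ)

omit [StarOrderedRing A] in
theorem mkDiam_mono {S T : Set (StateSpace A)} (h : S ⊆ T) : P.mkDiam S ≤ P.mkDiam T :=
  iSup₂_le fun _ hφ => iSup₂_le fun _ hψ => P.mkDist_le_mkDiam (h hφ) (h hψ)

-- The kernel of `φ - ψ` is a closed subspace containing the ball.
omit [StarOrderedRing A] in
theorem eq_of_mkDist_eq_zero {φ ψ : StateSpace A} (h : P.mkDist φ ψ = 0) : φ = ψ := by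
  let V : Submodule ℂ A :=
    LinearMap.ker ((WeakDual.toStrongDual φ.1 - WeakDual.toStrongDual ψ.1 : StrongDual ℂ A) :
      A →ₗ[ℂ] ℂ)
  have hV : V = ⊤ := by
    refine P.eq_top_of_ball_subset (ContinuousLinearMap.isClosed_ker
      (WeakDual.toStrongDual φ.1 - WeakDual.toStrongDual ψ.1 : StrongDual ℂ A)) fun a ha => ?_
    have h1 := P.enorm_sub_le_mkDist ha φ ψ
    rw [h, nonpos_iff_eq_zero, enorm_eq_zero] at h1
    exact h1
  refine Subtype.ext (ContinuousLinearMap.ext fun a => ?_)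
  have ha : a ∈ V := hV ▸ Submodule.mem_top
  exact sub_eq_zero.1 ha

omit [StarOrderedRing A] in
theorem t2Space_mkTopology : @T2Space (StateSpace A) P.mkTopology := by
  let : EMetricSpace (StateSpace A) :=
    { P.mkMetric with eq_of_edist_eq_zero := fun h => P.eq_of_mkDist_eq_zero h }
  infer_instance

/-- The weak* topology and the topology of the Monge-Kantorovich metric coincide as soon as the
former is finer. -/
theorem mkTopology_eq (h : instTopologicalSpaceSubtype ≤ P.mkTopology) :
    P.mkTopology = (instTopologicalSpaceSubtype : TopologicalSpace (StateSpace A)) := by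
  have hc : @Continuous _ _ instTopologicalSpaceSubtype P.mkTopology
      (id : StateSpace A → StateSpace A) := continuous_id_iff_le.2 h
  have hT := P.t2Space_mkTopology
  -- A continuous map from a compact space to a Hausdorff space is closed, so the identity is a
  -- homeomorphism.
  have hcl := @Continuous.isClosedMap _ _ instTopologicalSpaceSubtype P.mkTopology _ hT _ hc
  refine le_antisymm ?_ h
  rw [← continuous_id_iff_le, @continuous_iff_isClosed _ _ P.mkTopology]
  intro s hs
  have := hcl s hs
  rwa [image_id] at this

/-- If the Lipschitz ball is totally bounded modulo the scalars, then the Monge-Kantorovich metric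
induces the weak* topology. -/
theorem mkTopology_eq_of_totallyBounded
    (h : TotallyBounded ((Submodule.span ℂ {(1 : A)}).mkQ '' P.ball)) :
    P.mkTopology = (instTopologicalSpaceSubtype : TopologicalSpace (StateSpace A)) := by
  refine P.mkTopology_eq (continuous_id_iff_le.1 ?_)
  rw [@continuous_iff_continuousAt _ _ _ P.mkTopology]
  intro φ
  refine (@EMetric.tendsto_nhds _ _ P.mkMetric _ _ _).2 fun ε hε => ?_
  -- `ε` may be infinite; a finite `δ` below it permits real estimates.
  obtain ⟨δ, hδ, hδε⟩ := ENNReal.lt_iff_exists_nnreal_btwn.1 hε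
  have hδ0 : (0 : ℝ) < δ := by exact_mod_cast hδ
  obtain ⟨C, hC, hCf, hnet⟩ := P.exists_finite_net h (ε := δ / 3) (by positivity)
  have hev : ∀ᶠ ψ in @nhds (StateSpace A) instTopologicalSpaceSubtype φ,
      ∀ c ∈ C, ‖ψ.1 c - φ.1 c‖ < δ / 3 := by
    refine (hCf.eventually_all).2 fun c _ => ?_
    have hc : Continuous[instTopologicalSpaceSubtype, _] fun ψ : StateSpace A => ‖ψ.1 c - φ.1 c‖ :=
      (((WeakDual.eval_continuous c).comp continuous_subtype_val).sub continuous_const).norm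
    have h0 := hc.tendsto φ
    simp only [sub_self, norm_zero] at h0
    exact h0.eventually (gt_mem_nhds (by positivity))
  filter_upwards [hev] with ψ hψ
  refine lt_of_le_of_lt (iSup₂_le fun a ha => ?_) hδε
  obtain ⟨c, hc, z, hz⟩ := hnet a ha
  change ‖ψ.1 a - φ.1 a‖ₑ ≤ δ
  rw [enorm_le_coe]
  -- The scalar `z` cancels since both states are 1 at the unit. One third of `δ` goes to the net
  -- point and one to each remainder.
  have e : ψ.1 a - φ.1 a = (ψ.1 c - φ.1 c) + ψ.1 (a - c - z • (1 : A))
      - φ.1 (a - c - z • (1 : A)) := by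
    simp only [map_sub, map_smul, StateSpace.map_one]
    ring
  have h1 := (StateSpace.norm_apply_le ψ (a - c - z • (1 : A))).trans_lt hz
  have h2 := (StateSpace.norm_apply_le φ (a - c - z • (1 : A))).trans_lt hz
  have h3 := hψ c hc
  have h4 : ‖ψ.1 a - φ.1 a‖ ≤ δ := by
    rw [e]
    refine (norm_sub_le _ _).trans ?_
    have := norm_add_le (ψ.1 c - φ.1 c) (ψ.1 (a - c - z • (1 : A)))
    linarith
  exact_mod_cast h4

/-- A self-adjoint element as a function on the state space. -/
def stateEval : selfAdjoint A →+ BoundedContinuousFunction (StateSpace A) ℂ where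
  toFun a := BoundedContinuousFunction.mkOfCompact
    ⟨fun φ => φ.1 (a : A), (WeakDual.eval_continuous (a : A)).comp continuous_subtype_val⟩
  map_zero' := by ext φ; simp
  map_add' a b := by ext φ; simp

/-- Lets total boundedness of a set of functions on the state space be pulled back to the norm of
`A`. -/
theorem stateEval_isUniformInducing :
    IsUniformInducing (stateEval : selfAdjoint A → BoundedContinuousFunction (StateSpace A) ℂ) := by
  refine AntilipschitzWith.isUniformInducing (K := 3)
    (AddMonoidHomClass.antilipschitz_of_bound stateEval fun a => ?_)
    (AddMonoidHomClass.uniformContinuous_of_bound stateEval 1 fun a => ?_)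
  · exact norm_le_of_forall_state a.2 (fun φ => (stateEval a).norm_coe_le_norm φ) (norm_nonneg _)
  · rw [one_mul]
    exact (BoundedContinuousFunction.norm_le (norm_nonneg _)).2 fun φ => φ.norm_apply_le _

/-- If the Monge-Kantorovich metric is bounded and induces the weak* topology, then the Lipschitz
ball is totally bounded modulo the scalars. -/
theorem totallyBounded_of_mkTopology_eq (hd : P.mkDiam univ < ⊤)
    (ht : P.mkTopology = (instTopologicalSpaceSubtype : TopologicalSpace (StateSpace A))) :
    TotallyBounded ((Submodule.span ℂ {(1 : A)}).mkQ '' P.ball) := by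
  rcases isEmpty_or_nonempty (StateSpace A) with hE | ⟨⟨μ⟩⟩
  · have hA : Subsingleton A := by
      refine ⟨fun x y => ?_⟩
      have hz : ∀ a : A, IsSelfAdjoint a → a = 0 := fun a ha => by
        simpa using norm_le_of_forall_state ha (c := 0) (fun φ => hE.elim φ) le_rfl
      have h1 : (1 : A) = 0 := hz 1 (.one A)
      rw [← one_mul x, ← one_mul y, h1, zero_mul, zero_mul]
    exact ((Set.toFinite P.ball).image _).totallyBounded
  let B : Set (selfAdjoint A) := {b | (b : A) ∈ P.ballAt μ}
  have hB : TotallyBounded B := by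
    -- Arzelà-Ascoli: `μ b = 0` bounds the values by the diameter, and each `b` is 1-Lipschitz for
    -- the metric, whose balls are weak* neighbourhoods by `ht`.
    have hcpt : IsCompact (closure (stateEval '' B)) := by
      refine BoundedContinuousFunction.arzela_ascoli
        (Metric.closedBall (0 : ℂ) (P.mkDiam univ).toReal) (isCompact_closedBall _ _) _ ?_ ?_
      · rintro _ φ ⟨b, hb, rfl⟩
        have h1 := (P.enorm_sub_le_mkDist hb.1 φ μ).trans
          (P.mkDist_le_mkDiam (mem_univ φ) (mem_univ μ))
        rw [hb.2, sub_zero] at h1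
        rw [mem_closedBall_zero_iff]
        have h2 := ENNReal.toReal_mono hd.ne h1
        rwa [toReal_enorm] at h2
      · intro φ
        refine uniformity_basis_edist.equicontinuousAt_iff_right.2 fun ε hε => ?_
        have h1 : ∀ᶠ ψ in @nhds _ P.mkTopology φ, P.mkDist ψ φ < ε :=
          @Metric.eball_mem_nhds _ P.mkMetric φ ε hε
        rw [ht] at h1
        filter_upwards [h1] with ψ hψ
        rintro ⟨_, b, hb, rfl⟩
        rw [edist_comm, edist_eq_enorm_sub]
        exact (P.enorm_sub_le_mkDist hb.1 ψ φ).trans_lt hψ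
    exact (totallyBounded_preimage stateEval_isUniformInducing
      (hcpt.totallyBounded.subset subset_closure)).subset (subset_preimage_image _ _)
  have hB' := hB.image (uniformContinuous_subtype_val (p := (· ∈ selfAdjoint A)))
  have hq : UniformContinuous (Submodule.span ℂ {(1 : A)}).mkQ :=
    AddMonoidHomClass.uniformContinuous_of_bound _ 1 fun a => by
      rw [one_mul]
      exact Submodule.Quotient.norm_mk_le _ a
  refine (hB'.image hq).subset ?_
  rintro _ ⟨a, ha, rfl⟩
  have hsa := P.isSelfAdjoint_of_mem_ball ha
  -- Subtracting `μ a` leaves the class modulo scalars unchanged and moves `a` into `B`.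
  have hmem := P.add_real_smul_one_mem_ball ha (-(μ.1 a).re)
  refine ⟨_, ⟨⟨_, P.isSelfAdjoint_of_mem_ball hmem⟩, ⟨hmem, ?_⟩, rfl⟩, ?_⟩
  · rw [map_add, map_smul, μ.map_one, Complex.ofReal_neg, μ.ofReal_re_apply hsa, smul_eq_mul]
    ring
  · refine (Submodule.Quotient.eq _).2 (Submodule.mem_span_singleton.2 ⟨((-(μ.1 a).re : ℝ) : ℂ), ?_⟩)
    simp

/-! ### Compact quantum metric spaces -/

/-- The two topologies agree on the whole state space, so tameness plays no role. -/
theorem IsCompactQuantumMetricSpace.isQuantumLocallyCompactSeparable {P : LipschitzPair A}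
    (h : P.IsCompactQuantumMetricSpace) {M : AbelianCStarSubalgebra A}
    (h1 : (1 : A) ∈ M.toSubalgebra) : P.IsQuantumLocallyCompactSeparable M := by
  refine ⟨⟨M.isTopography_iff_one_mem.2 h1,
    fun K => (P.mkDiam_mono (subset_univ _)).trans_lt h.2.1, fun S _ => ?_⟩,
    P.separableSpace_of_totallyBounded h.2.2⟩
  rw [P.mkTopology_eq_of_totallyBounded h.2.2]
  rfl

theorem IsQuantumLocallyCompact.isCompactQuantumMetricSpace {P : LipschitzPair A}
    {M : AbelianCStarSubalgebra A} (h : P.IsQuantumLocallyCompact M) :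
    P.IsCompactQuantumMetricSpace := by
  obtain ⟨hM, hreg, htame⟩ := h
  have h1 : (1 : A) ∈ M.toSubalgebra := M.isTopography_iff_one_mem.1 hM
  have := M.compactSpace_spectrum h1
  have hone : indicator M ((⊤ : Compacts M.Spectrum) : Set M.Spectrum)
      = NormedSpace.inclusionInDoubleDual ℂ A 1 := indicator_univ M h1
  have hall : statesOn M ⊤ = univ := by
    refine eq_univ_of_forall fun φ => ?_
    change indicator M ((⊤ : Compacts M.Spectrum) : Set M.Spectrum) φ.toDual = 1
    rw [hone]
    exact φ.map_one
  have hd : P.mkDiam univ < ⊤ := hall ▸ hreg ⊤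
  refine ⟨fun a => ?_, hd, P.totallyBounded_of_mkTopology_eq hd ?_⟩
  · have := Set.ext_iff.1 P.ker_eq a
    exact ⟨fun h0 => this.1 ⟨a.2, h0⟩, fun h0 => (this.2 h0).2⟩
  -- Tameness needs a state `μ`; with no states there is only one topology.
  rcases isEmpty_or_nonempty (StateSpace A) with hE | ⟨⟨μ⟩⟩
  · exact Subsingleton.elim _ _
  have ht : P.IsTame M univ := by
    refine ⟨μ, mem_iUnion.2 ⟨⊤, hall ▸ mem_univ μ⟩, ?_⟩
    -- The limit is the value at `K = ⊤`, where `a - 1_K a 1_K = 0`.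
    rw [OrderTop.atTop_eq, tendsto_pure_left]
    intro s hs
    convert mem_of_mem_nhds hs
    simp only [hone, bidualMul_inclusion, one_mul, mul_one]
    simp
  have key := htame univ ht
  rw [← induced_id (t := P.mkTopology), ← induced_id (t := instTopologicalSpaceSubtype)]
  have e : (id : StateSpace A → StateSpace A)
      = (Subtype.val : ↥(univ : Set (StateSpace A)) → StateSpace A) ∘
        fun φ => (⟨φ, mem_univ φ⟩ : ↥(univ : Set (StateSpace A))) := rfl
  rw [e, ← induced_compose, key, ← induced_compose]
  rfl

end LipschitzPair

end QuantumMetric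

end

theorem mainTheorem9 {A : Type*} [CStarAlgebra A] [PartialOrder A] [StarOrderedRing A]
    (P : QuantumMetric.LipschitzPair A) :
    (∀ M : QuantumMetric.AbelianCStarSubalgebra A,
      M.IsTopography ↔ (1 : A) ∈ M.toSubalgebra) ∧
    [P.IsCompactQuantumMetricSpace,
      P.IsQuantumLocallyCompact (QuantumMetric.AbelianCStarSubalgebra.scalars A),
      ∀ M : QuantumMetric.AbelianCStarSubalgebra A, (1 : A) ∈ M.toSubalgebra →
        P.IsQuantumLocallyCompactSeparable M,
      ∃ M : QuantumMetric.AbelianCStarSubalgebra A, (1 : A) ∈ M.toSubalgebra ∧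
        P.IsQuantumLocallyCompact M,
      ∀ (h : A) (hh : QuantumMetric.StrictlyPositive h),
        P.IsQuantumLocallyCompactSeparable hh.algebra,
      ∃ (h : A) (hh : QuantumMetric.StrictlyPositive h),
        P.IsQuantumLocallyCompact hh.algebra].TFAE := by
  refine ⟨fun M => M.isTopography_iff_one_mem, ?_⟩
  have hscalars : (1 : A) ∈ (QuantumMetric.AbelianCStarSubalgebra.scalars A).toSubalgebra :=
    ⟨1, one_smul ℂ 1⟩
  tfae_have 1 → 3 := fun h M hM => h.isQuantumLocallyCompactSeparable hM
  tfae_have 3 → 2 := fun h => (h _ hscalars).1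
  tfae_have 2 → 4 := fun h => ⟨_, hscalars, h⟩
  tfae_have 4 → 1 := fun ⟨_, _, h⟩ => h.isCompactQuantumMetricSpace
  tfae_have 3 → 5 := fun h _ hh => h _ hh.one_mem_algebra
  tfae_have 5 → 6 := fun h => ⟨1, QuantumMetric.strictlyPositive_one, (h _ _).1⟩
  tfae_have 6 → 1 := fun ⟨_, _, h⟩ => h.isCompactQuantumMetricSpace
  tfae_finish
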